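/- Let $N\ge 1$ and let $M\in\mathbb{R}^{N\times N}$ have positive entries. For $x\in\mathbb{R}_{+}^N$ (where $\mathbb{R}_+=[0,\infty)$) put $$\varrho_M(x):=\rho(\mathrm{diag}(x)M):=\sup\{\lambda\ge 0 \mid \mathrm{diag}(x)Mv=\lambda v \text{ for some } v\in\mathbb{R}_+^N\setminus\{0\}\}.$$ Let $x\in\mathbb{R}^N$ have positive coordinates. Then $\varrho_M(x)>0$, and $\varrho_M(x)$ equals the usual spectral radius (largest absolute value of a complex eigenvalue) of the matrix $\mathrm{diag}(x)M$. There exist vectors $\xi,\eta\in\mathbb{R}^N$ with positive coordinates such that $$\mathrm{diag}(x)M\xi=\varrho_M(x)\,\xi,\qquad \eta^{\mathsf T}\mathrm{diag}(x)M=\varrho_M(x)\,\eta^{\mathsf T}.$$ The function $\varrho_M$ is Fréchet differentiable at $x$, and for every such pair $\xi,\eta$ its gradient (with respect to the Euclidean inner product) is $$\nabla\varrho_M(x)=\frac{\mathrm{diag}(\eta)M\xi}{\eta^{\mathsf T}\xi}.$$ -/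

import Mathlib

/-- The spectral radius `ρ(G)` of a mapping `G` of the nonnegative orthant into itself: the supremum
of all `μ ≥ 0` with `G v = μ v` for some nonzero nonnegative vector `v`. Only the values of `G` on
the nonnegative orthant matter. -/
noncomputable def coneSpectralRadius {N : ℕ} (G : (Fin N → ℝ) → (Fin N → ℝ)) : ℝ :=
  sSup {μ : ℝ | 0 ≤ μ ∧ ∃ v : Fin N → ℝ, (∀ i, 0 ≤ v i) ∧ v ≠ 0 ∧ G v = μ • v}

/-- The nonlinear spectral radius function `x ↦ ρ(p ↦ diag(x) G(p))`, as a function on Euclidean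
space; it is meant on the nonnegative orthant. -/
noncomputable def spectralRadiusFun {N : ℕ} (G : (Fin N → ℝ) → (Fin N → ℝ))
    (x : EuclideanSpace ℝ (Fin N)) : ℝ :=
  coneSpectralRadius fun p => Matrix.mulVec (Matrix.diagonal fun i => x i) (G p)

/-- The function `x ↦ ρ(diag(x) M)` of a matrix `M`: the case `G p = M p`. -/
noncomputable def matrixSpectralRadiusFun {N : ℕ} (M : Matrix (Fin N) (Fin N) ℝ) :
    EuclideanSpace ℝ (Fin N) → ℝ :=
  spectralRadiusFun fun p => M.mulVec p

/-- `ξ` and `η` are positive right and left eigenvectors of `A` for the eigenvalue `μ`. -/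
structure IsPositiveEigenpair {N : ℕ} (A : Matrix (Fin N) (Fin N) ℝ) (μ : ℝ)
    (ξ η : Fin N → ℝ) : Prop where
  right_pos : ∀ i, 0 < ξ i
  left_pos : ∀ i, 0 < η i
  right_eigen : A.mulVec ξ = μ • ξ
  left_eigen : Matrix.vecMul η A = μ • η

open Matrix Filter Topology

/-! ### Perron theory for matrices with positive entries. -/

section PositiveMatrix

variable {n : Type*} [Fintype n]

/-! Perron's theorem (`exists_pos_eigenvector`) for `A = diag(x) M` and `Aᵀ` yields `ξ` and `η`;
pairing with `η > 0` forces a single eigenvalue on all nonnegative eigenvectors and dominates the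
complex ones.

For the gradient, let `v y` be a nonnegative eigenvector of `diag(y) M` with `η ⬝ᵥ v y = 1`. Pairing
with `η` gives the exact identity `r y - r x = ⟨diag(η) M (v y), y - x⟩` (`eigenvalue_sub_eq_sum`),
so only `v y → ξ / (η ⬝ᵥ ξ)` is needed. This follows from compactness and simplicity of the Perron
eigenvalue (`exists_eq_smul_of_pos_eigenvector`). -/

theorem dotProduct_pos_of_pos_of_nonneg_of_ne_zero {u v : n → ℝ} (hu : ∀ i, 0 < u i)
    (hv : ∀ i, 0 ≤ v i) (hv0 : v ≠ 0) : 0 < u ⬝ᵥ v := by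
  obtain ⟨j, hj⟩ := Function.ne_iff.mp hv0
  exact Finset.sum_pos' (fun i _ => mul_nonneg (hu i).le (hv i))
    ⟨j, Finset.mem_univ j, mul_pos (hu j) (lt_of_le_of_ne (hv j) (Ne.symm hj))⟩

theorem mulVec_pos_of_nonneg_of_ne_zero {A : Matrix n n ℝ} (hA : ∀ i j, 0 < A i j) {v : n → ℝ}
    (hv : ∀ i, 0 ≤ v i) (hv0 : v ≠ 0) (i : n) : 0 < (A *ᵥ v) i :=
  dotProduct_pos_of_pos_of_nonneg_of_ne_zero (hA i) hv hv0

/-- A nonnegative nonzero eigenvector of a positive matrix is positive. -/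
theorem pos_of_nonneg_of_mulVec_eq_smul {A : Matrix n n ℝ} (hA : ∀ i j, 0 < A i j) {μ : ℝ}
    {v : n → ℝ} (hv : ∀ i, 0 ≤ v i) (hv0 : v ≠ 0) (h : A *ᵥ v = μ • v) : 0 < μ ∧ ∀ i, 0 < v i := by
  have hpos : ∀ i, 0 < μ * v i := fun i => by
    have := mulVec_pos_of_nonneg_of_ne_zero hA hv hv0 i
    rwa [h] at this
  obtain ⟨j, -⟩ := Function.ne_iff.mp hv0
  have hμ : 0 < μ := pos_of_mul_pos_left (hpos j) (hv j)
  exact ⟨hμ, fun i => pos_of_mul_pos_right (hpos i) hμ.le⟩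

/-- **Perron's theorem**, existence: the eigenvalue is the maximum of the Collatz–Wielandt
function on the standard simplex. -/
theorem exists_pos_eigenvector [Nonempty n] {A : Matrix n n ℝ} (hA : ∀ i j, 0 < A i j) :
    ∃ μ : ℝ, 0 < μ ∧ ∃ v : n → ℝ, (∀ i, 0 < v i) ∧ A *ᵥ v = μ • v := by
  classical
  set C : ℝ := ∑ i, ∑ j, A i j with hC
  have hbound : ∀ (l : ℝ) (v : n → ℝ), v ∈ stdSimplex ℝ n → (∀ i, l * v i ≤ (A *ᵥ v) i) →
      l ≤ C := by
    intro l v hv h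
    calc l = ∑ i, l * v i := by rw [← Finset.mul_sum, hv.2, mul_one]
      _ ≤ ∑ i, (A *ᵥ v) i := Finset.sum_le_sum fun i _ => h i
      _ ≤ C := Finset.sum_le_sum fun i _ => Finset.sum_le_sum fun j _ =>
        mul_le_of_le_one_right (hA i j).le
          (hv.2 ▸ Finset.single_le_sum (fun k _ => hv.1 k) (Finset.mem_univ j))
  set S : Set (ℝ × (n → ℝ)) :=
    (Set.Icc 0 C ×ˢ stdSimplex ℝ n) ∩ {p | ∀ i, p.1 * p.2 i ≤ (A *ᵥ p.2) i} with hS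
  have hScomp : IsCompact S := by
    refine (isCompact_Icc.prod (isCompact_stdSimplex ℝ n)).inter_right ?_
    rw [Set.ofPred_forall]
    refine isClosed_iInter fun i => isClosed_le (by fun_prop) ?_
    exact (continuous_apply i).comp (continuous_const.matrix_mulVec continuous_snd)
  have hmem : ∀ (l : ℝ) (v : n → ℝ), 0 ≤ l → v ∈ stdSimplex ℝ n →
      (∀ i, l * v i ≤ (A *ᵥ v) i) → (l, v) ∈ S :=
    fun l v hl hv h => ⟨⟨⟨hl, hbound l v hv h⟩, hv⟩, h⟩
  have hne0 : ∀ v ∈ stdSimplex ℝ n, v ≠ 0 := by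
    rintro v hv rfl
    simpa using hv.2
  have hSne : S.Nonempty := by
    obtain ⟨i⟩ := ‹Nonempty n›
    refine ⟨(0, Pi.single i 1), hmem _ _ le_rfl (single_mem_stdSimplex ℝ i) fun k => ?_⟩
    rw [zero_mul]
    have := single_mem_stdSimplex ℝ i
    exact (mulVec_pos_of_nonneg_of_ne_zero hA this.1 (hne0 _ this) k).le
  obtain ⟨⟨l, v⟩, ⟨⟨⟨hl, -⟩, hv⟩, hlv⟩, hmax⟩ :=
    hScomp.exists_isMaxOn hSne continuous_fst.continuousOn
  simp only at hl hv hlv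
  have hAv : A *ᵥ v = l • v := by
    -- If `u = A v ≠ l v`, then `A (u - l v) > 0` strictly, so the normalized `u` admits a value
    -- larger than `l`.
    by_contra hne
    set u := A *ᵥ v with hu
    have hupos : ∀ i, 0 < u i := mulVec_pos_of_nonneg_of_ne_zero hA hv.1 (hne0 v hv)
    have hw : ∀ i, 0 < (A *ᵥ (u - l • v)) i :=
      mulVec_pos_of_nonneg_of_ne_zero hA (fun i => sub_nonneg.mpr (hlv i)) (sub_ne_zero.mpr hne)
    -- The minimal ratio is the largest `ε` with `(l + ε) u ≤ A u`.
    obtain ⟨k, hk⟩ := Finite.exists_min fun i => (A *ᵥ (u - l • v)) i / u i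
    set ε := (A *ᵥ (u - l • v)) k / u k with hε
    have hεpos : 0 < ε := div_pos (hw k) (hupos k)
    have hs : 0 < ∑ i, u i := Finset.sum_pos (fun i _ => hupos i) Finset.univ_nonempty
    have : (l + ε, (∑ i, u i)⁻¹ • u) ∈ S := by
      refine hmem _ _ (by positivity) ⟨fun i => ?_, ?_⟩ fun i => ?_
      · exact mul_nonneg (inv_nonneg.mpr hs.le) (hupos i).le
      · simp only [Pi.smul_apply, smul_eq_mul, ← Finset.mul_sum]
        exact inv_mul_cancel₀ hs.ne'
      · have h1 := (le_div_iff₀ (hupos i)).mp (hk i)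
        rw [mulVec_sub, mulVec_smul, ← hu, Pi.sub_apply, Pi.smul_apply, smul_eq_mul] at h1
        rw [mulVec_smul, Pi.smul_apply, Pi.smul_apply, smul_eq_mul, smul_eq_mul, mul_left_comm]
        exact mul_le_mul_of_nonneg_left (by linarith) (inv_nonneg.mpr hs.le)
    have := hmax this
    simp only [Set.mem_ofPred_eq] at this
    linarith
  obtain ⟨h1, h2⟩ := pos_of_nonneg_of_mulVec_eq_smul hA hv.1 (hne0 v hv) hAv
  exact ⟨l, h1, v, h2, hAv⟩

/-- A left positive eigenvector pins the eigenvalue of every nonnegative right eigenvector. -/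
theorem eigenvalue_eq_of_left_pos {A : Matrix n n ℝ} {μ l : ℝ} {η v : n → ℝ}
    (hη : ∀ i, 0 < η i) (hηA : η ᵥ* A = μ • η) (hv : ∀ i, 0 ≤ v i) (hv0 : v ≠ 0)
    (h : A *ᵥ v = l • v) : l = μ := by
  have h1 : η ⬝ᵥ A *ᵥ v = (η ᵥ* A) ⬝ᵥ v := dotProduct_mulVec _ _ _
  rw [h, hηA, dotProduct_smul, smul_dotProduct, smul_eq_mul, smul_eq_mul] at h1
  exact mul_right_cancel₀ (dotProduct_pos_of_pos_of_nonneg_of_ne_zero hη hv hv0).ne' h1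

/-- A nonnegative eigenvector of a positive matrix is a multiple of any other eigenvector that is
positive and has the same eigenvalue. -/
theorem exists_eq_smul_of_pos_eigenvector [Nonempty n] {A : Matrix n n ℝ}
    (hA : ∀ i j, 0 < A i j) {μ : ℝ} {ξ v : n → ℝ} (hξ : ∀ i, 0 < ξ i) (hAξ : A *ᵥ ξ = μ • ξ)
    (hAv : A *ᵥ v = μ • v) : ∃ t : ℝ, v = t • ξ := by
  -- Subtracting the largest multiple of `ξ` below `v` leaves a nonnegative vector vanishing at `k`;
  -- were it nonzero, it would be a positive eigenvector.
  obtain ⟨k, hk⟩ := Finite.exists_min fun i => v i / ξ i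
  refine ⟨v k / ξ k, ?_⟩
  by_contra hne
  have hnonneg : ∀ i, 0 ≤ (v - (v k / ξ k) • ξ) i := fun i =>
    sub_nonneg.mpr ((le_div_iff₀ (hξ i)).mp (hk i))
  have hpos := (pos_of_nonneg_of_mulVec_eq_smul hA hnonneg (sub_ne_zero.mpr hne) (μ := μ) (by
    rw [mulVec_sub, mulVec_smul, hAξ, hAv, smul_sub, smul_comm])).2 k
  rw [Pi.sub_apply, Pi.smul_apply, smul_eq_mul, div_mul_cancel₀ _ (hξ k).ne', sub_self] at hpos
  exact lt_irrefl _ hpos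

/-- The triangle inequality gives `‖l‖ |z| ≤ A |z|` entrywise; pairing with `η` finishes. -/
theorem norm_le_of_hasEigenvector_of_left_pos {A : Matrix n n ℝ} (hA : ∀ i j, 0 ≤ A i j) {μ : ℝ}
    {η : n → ℝ} (hη : ∀ i, 0 < η i) (hηA : η ᵥ* A = μ • η) {l : ℂ} {z : n → ℂ} (hz : z ≠ 0)
    (h : A.map Complex.ofReal *ᵥ z = l • z) : ‖l‖ ≤ μ := by
  set w : n → ℝ := fun i => ‖z i‖ with hw
  have hw0 : w ≠ 0 := fun h0 => hz (funext fun i => norm_eq_zero.mp (congrFun h0 i))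
  have hle : ∀ i, ‖l‖ * w i ≤ (A *ᵥ w) i := fun i => by
    calc ‖l‖ * w i = ‖(A.map Complex.ofReal *ᵥ z) i‖ := by rw [h, Pi.smul_apply, norm_smul]
      _ ≤ ∑ j, ‖(A i j : ℂ) * z j‖ := norm_sum_le _ _
      _ = (A *ᵥ w) i := Finset.sum_congr rfl fun j _ => by
        rw [norm_mul, Complex.norm_of_nonneg (hA i j)]
  have h1 : η ⬝ᵥ A *ᵥ w = (η ᵥ* A) ⬝ᵥ w := dotProduct_mulVec _ _ _
  have h2 : η ⬝ᵥ (‖l‖ • w) ≤ η ⬝ᵥ A *ᵥ w :=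
    Finset.sum_le_sum fun i _ => mul_le_mul_of_nonneg_left (hle i) (hη i).le
  rw [h1, hηA, dotProduct_smul, smul_dotProduct, smul_eq_mul, smul_eq_mul] at h2
  exact le_of_mul_le_mul_right h2
    (dotProduct_pos_of_pos_of_nonneg_of_ne_zero hη (fun i => norm_nonneg _) hw0)

theorem mem_spectrum_iff_exists_mulVec_eq_smul [DecidableEq n] {K : Type*} [Field K]
    {B : Matrix n n K} {l : K} : l ∈ spectrum K B ↔ ∃ z : n → K, z ≠ 0 ∧ B *ᵥ z = l • z := by
  rw [← Matrix.spectrum_toLin', ← Module.End.hasEigenvalue_iff_mem_spectrum]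
  constructor
  · intro h
    obtain ⟨z, hz⟩ := h.exists_hasEigenvector
    exact ⟨z, hz.2, by simpa using hz.apply_eq_smul⟩
  · rintro ⟨z, hz, h⟩
    exact Module.End.hasEigenvalue_of_hasEigenvector (x := z)
      ⟨Module.End.mem_eigenspace_iff.mpr (by simpa using h), hz⟩

theorem spectralRadius_map_ofReal_eq [DecidableEq n] [Nonempty n] {A : Matrix n n ℝ}
    (hA : ∀ i j, 0 ≤ A i j) {μ : ℝ} {ξ η : n → ℝ} (hξ : ∀ i, 0 < ξ i) (hη : ∀ i, 0 < η i)
    (hAξ : A *ᵥ ξ = μ • ξ) (hηA : η ᵥ* A = μ • η) : spectralRadius ℂ (A.map Complex.ofReal) = ENNReal.ofReal μ := by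
  refine le_antisymm (iSup₂_le fun l hl => ?_) ?_
  · obtain ⟨z, hz, h⟩ := mem_spectrum_iff_exists_mulVec_eq_smul.mp hl
    rw [← enorm_eq_nnnorm, ← ofReal_norm]
    exact ENNReal.ofReal_le_ofReal (norm_le_of_hasEigenvector_of_left_pos hA hη hηA hz h)
  · have hmem : (μ : ℂ) ∈ spectrum ℂ (A.map Complex.ofReal) := by
      refine mem_spectrum_iff_exists_mulVec_eq_smul.mpr ⟨fun i => (ξ i : ℂ), fun h0 => ?_, ?_⟩
      · obtain ⟨i⟩ := ‹Nonempty n›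
        exact (hξ i).ne' (Complex.ofReal_eq_zero.mp (congrFun h0 i))
      · ext i
        have := congrArg Complex.ofReal (congrFun hAξ i)
        simpa [mulVec, dotProduct] using this
    refine le_trans ?_ (le_iSup₂ (f := fun (k : ℂ) (_ : k ∈ spectrum ℂ (A.map Complex.ofReal)) =>
      (‖k‖₊ : ENNReal)) (μ : ℂ) hmem)
    rw [← enorm_eq_nnnorm, ← ofReal_norm]
    exact ENNReal.ofReal_le_ofReal (by simpa using le_abs_self μ)

theorem diagonal_mul_pos [DecidableEq n] {M : Matrix n n ℝ} (hM : ∀ i j, 0 < M i j) {x : n → ℝ}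
    (hx : ∀ i, 0 < x i) (i j : n) : 0 < (diagonal x * M) i j := by
  rw [diagonal_mul]
  exact mul_pos (hx i) (hM i j)

/-- Nonnegative vectors normalized against a positive functional form a compact set. -/
theorem isCompact_nonneg_inter_dotProduct_eq_one {η : n → ℝ} (hη : ∀ i, 0 < η i) :
    IsCompact {v : n → ℝ | (∀ i, 0 ≤ v i) ∧ η ⬝ᵥ v = 1} := by
  refine (isCompact_Icc (a := (0 : n → ℝ)) (b := fun i => (η i)⁻¹)).of_isClosed_subset ?_ ?_
  · refine IsClosed.inter ?_ (isClosed_eq (by unfold dotProduct; fun_prop) continuous_const)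
    exact isClosed_le continuous_const continuous_id
  · rintro v ⟨hv, hv1⟩
    refine ⟨hv, fun i => ?_⟩
    change v i ≤ (η i)⁻¹
    rw [← one_div, le_div_iff₀' (hη i), ← hv1]
    exact Finset.single_le_sum (f := fun j => η j * v j)
      (fun j _ => mul_nonneg (hη j).le (hv j)) (Finset.mem_univ i)

end PositiveMatrix

/-! ### The cone spectral radius as Perron eigenvalue, and its gradient. -/

section SpectralRadiusFun

variable {N : ℕ}

theorem coneSpectralRadius_mulVec_eq {A : Matrix (Fin N) (Fin N) ℝ} [Nonempty (Fin N)] {μ : ℝ}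
    {ξ η : Fin N → ℝ} (hμ : 0 ≤ μ) (h : IsPositiveEigenpair A μ ξ η) :
    coneSpectralRadius (fun p => A *ᵥ p) = μ := by
  have : {l : ℝ | 0 ≤ l ∧ ∃ v : Fin N → ℝ, (∀ i, 0 ≤ v i) ∧ v ≠ 0 ∧ A *ᵥ v = l • v} = {μ} := by
    ext l
    constructor
    · rintro ⟨-, v, hv, hv0, hAv⟩
      exact eigenvalue_eq_of_left_pos h.left_pos h.left_eigen hv hv0 hAv
    · rintro rfl
      refine ⟨hμ, ξ, fun i => (h.right_pos i).le, fun h0 => ?_, h.right_eigen⟩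
      obtain ⟨i⟩ := ‹Nonempty (Fin N)›
      exact (h.right_pos i).ne' (congrFun h0 i)
  rw [coneSpectralRadius, this, csSup_singleton]

theorem exists_isPositiveEigenpair [Nonempty (Fin N)] {A : Matrix (Fin N) (Fin N) ℝ}
    (hA : ∀ i j, 0 < A i j) :
    0 < coneSpectralRadius (fun p => A *ᵥ p) ∧
      ∃ ξ η, IsPositiveEigenpair A (coneSpectralRadius fun p => A *ᵥ p) ξ η := by
  obtain ⟨μ, hμ, ξ, hξ, hAξ⟩ := exists_pos_eigenvector hA
  obtain ⟨ν, -, η, hη, hAη⟩ := exists_pos_eigenvector (A := Aᵀ) fun i j => hA j i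
  rw [mulVec_transpose] at hAη
  have hξ0 : ξ ≠ 0 := fun h0 => by
    obtain ⟨i⟩ := ‹Nonempty (Fin N)›
    exact (hξ i).ne' (congrFun h0 i)
  obtain rfl := eigenvalue_eq_of_left_pos hη hAη (fun i => (hξ i).le) hξ0 hAξ
  have h : IsPositiveEigenpair A μ ξ η := ⟨hξ, hη, hAξ, hAη⟩
  rw [coneSpectralRadius_mulVec_eq hμ.le h]
  exact ⟨hμ, ξ, η, h⟩

theorem matrixSpectralRadiusFun_eq (M : Matrix (Fin N) (Fin N) ℝ) (x : EuclideanSpace ℝ (Fin N)) :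
    matrixSpectralRadiusFun M x =
      coneSpectralRadius fun p => (diagonal (fun i => x i) * M) *ᵥ p := by
  simp only [matrixSpectralRadiusFun, spectralRadiusFun, mulVec_mulVec]

/-- A right eigenvector at a positive `y`, normalized against `η`. -/
theorem exists_normalized_eigenvector [Nonempty (Fin N)] {M : Matrix (Fin N) (Fin N) ℝ}
    (hM : ∀ i j, 0 < M i j) {η : Fin N → ℝ} (hη : ∀ i, 0 < η i) {y : EuclideanSpace ℝ (Fin N)}
    (hy : ∀ i, 0 < y i) :
    ∃ v : Fin N → ℝ, ((∀ i, 0 ≤ v i) ∧ η ⬝ᵥ v = 1) ∧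
      (diagonal (fun i => y i) * M) *ᵥ v = matrixSpectralRadiusFun M y • v := by
  obtain ⟨-, ξ, _, h⟩ := exists_isPositiveEigenpair (diagonal_mul_pos hM hy)
  rw [← matrixSpectralRadiusFun_eq] at h
  have hpos : 0 < η ⬝ᵥ ξ :=
    Finset.sum_pos (fun i _ => mul_pos (hη i) (h.right_pos i)) Finset.univ_nonempty
  refine ⟨(η ⬝ᵥ ξ)⁻¹ • ξ, ⟨fun i => ?_, ?_⟩, ?_⟩
  · exact mul_nonneg (inv_nonneg.mpr hpos.le) (h.right_pos i).le
  · rw [dotProduct_smul, smul_eq_mul, inv_mul_cancel₀ hpos.ne']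
  · rw [mulVec_smul, h.right_eigen, smul_comm]

/-- Exact first-order expansion of an eigenvalue in terms of the perturbed right eigenvector. -/
theorem eigenvalue_sub_eq_sum {M : Matrix (Fin N) (Fin N) ℝ} {x y η v : Fin N → ℝ} {μ ν : ℝ}
    (hη : η ᵥ* (diagonal x * M) = μ • η) (hv : (diagonal y * M) *ᵥ v = ν • v)
    (hηv : η ⬝ᵥ v = 1) : ν - μ = ∑ i, (y i - x i) * (η i * (M *ᵥ v) i) := by
  have h1 : η ⬝ᵥ (diagonal x * M) *ᵥ v = μ := by
    rw [dotProduct_mulVec, hη, smul_dotProduct, hηv, smul_eq_mul, mul_one]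
  have h2 : η ⬝ᵥ (diagonal y * M) *ᵥ v = ν := by
    rw [hv, dotProduct_smul, hηv, smul_eq_mul, mul_one]
  rw [← h1, ← h2, ← mulVec_mulVec, ← mulVec_mulVec, dotProduct, dotProduct,
    ← Finset.sum_sub_distrib]
  refine Finset.sum_congr rfl fun i _ => ?_
  rw [mulVec_diagonal, mulVec_diagonal]
  ring

theorem hasGradientAt_matrixSpectralRadiusFun [Nonempty (Fin N)] {M : Matrix (Fin N) (Fin N) ℝ}
    (hM : ∀ i j, 0 < M i j) {x : EuclideanSpace ℝ (Fin N)} (hx : ∀ i, 0 < x i)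
    {ξ η : Fin N → ℝ}
    (h : IsPositiveEigenpair (diagonal (fun i => x i) * M) (matrixSpectralRadiusFun M x) ξ η) :
    HasGradientAt (matrixSpectralRadiusFun M)
      (WithLp.toLp 2 ((η ⬝ᵥ ξ)⁻¹ • diagonal η *ᵥ (M *ᵥ ξ))) x := by
  set r := matrixSpectralRadiusFun M with hr
  set K : Set (Fin N → ℝ) := {v | (∀ i, 0 ≤ v i) ∧ η ⬝ᵥ v = 1} with hK
  have hKc : IsCompact K := isCompact_nonneg_inter_dotProduct_eq_one h.left_pos
  have hev : ∀ᶠ y : EuclideanSpace ℝ (Fin N) in 𝓝 x, ∀ i, 0 < y i :=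
    eventually_all.mpr fun i =>
      (EuclideanSpace.proj (𝕜 := ℝ) i).continuous.continuousAt.eventually (lt_mem_nhds (hx i))
  have hex : ∀ y : EuclideanSpace ℝ (Fin N), ∃ v : Fin N → ℝ, (∀ i, 0 < y i) →
      v ∈ K ∧ (diagonal (fun i => y i) * M) *ᵥ v = r y • v := fun y => by
    by_cases hy : ∀ i, 0 < y i
    · obtain ⟨v, hv⟩ := exists_normalized_eigenvector hM h.left_pos hy
      exact ⟨v, fun _ => hv⟩
    -- Default value off the positive orthant, irrelevant near `x`.
    · exact ⟨0, fun hy' => absurd hy' hy⟩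
  choose v hv using hex
  have hvK : ∀ᶠ y in 𝓝 x, v y ∈ K := hev.mono fun y hy => (hv y hy).1
  have hsub : ∀ᶠ y in 𝓝 x, r y - r x = ∑ i, (y i - x i) * (η i * (M *ᵥ v y) i) :=
    hev.mono fun y hy => eigenvalue_sub_eq_sum h.left_eigen (hv y hy).2 (hv y hy).1.2
  have hcoord : ∀ i, Tendsto (fun y : EuclideanSpace ℝ (Fin N) => y i - x i) (𝓝 x) (𝓝 0) :=
    fun i => by
      have := ((EuclideanSpace.proj (𝕜 := ℝ) i).continuous.tendsto x).sub_const (x i)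
      simpa using this
  have hsmall : ∀ (i : Fin N) (f : (Fin N → ℝ) → ℝ), Continuous f →
      Tendsto (fun y => (y i - x i) * f (v y)) (𝓝 x) (𝓝 0) := by
    intro i f hf
    obtain ⟨C, hC⟩ := hKc.exists_bound_of_continuousOn hf.continuousOn
    exact (hcoord i).zero_mul_isBoundedUnder_le
      (isBoundedUnder_of_eventually_le (a := C) (hvK.mono fun y hy => hC _ hy))
  have hmulVec : ∀ i, Continuous fun w : Fin N → ℝ => (M *ᵥ w) i := fun i =>
    (continuous_apply i).comp (continuous_const.matrix_mulVec continuous_id)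
  -- Continuity of `r` at `x` needs only boundedness of `v`, not its convergence.
  have hrx : Tendsto (fun y => r y - r x) (𝓝 x) (𝓝 0) := by
    have : Tendsto (fun y : EuclideanSpace ℝ (Fin N) =>
        ∑ i, (y i - x i) * (η i * (M *ᵥ v y) i)) (𝓝 x) (𝓝 (∑ _i : Fin N, 0)) :=
      tendsto_finsetSum _ fun i _ => hsmall i (fun w => η i * (M *ᵥ w) i)
        (continuous_const.mul (hmulVec i))
    rw [Finset.sum_const_zero] at this
    exact this.congr' (hsub.mono fun y hy => hy.symm)
  -- By the eigenvector equation at `y`, this residual equals `(r y - r x) * v y i - (y i - x i) *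
  -- (M *ᵥ v y) i`.
  have hres : ∀ i, Tendsto (fun y => x i * (M *ᵥ v y) i - r x * v y i) (𝓝 x) (𝓝 0) := by
    intro i
    obtain ⟨C, hC⟩ := hKc.exists_bound_of_continuousOn (continuous_apply i).continuousOn
    have h2 : Tendsto (fun y => (r y - r x) * v y i) (𝓝 x) (𝓝 0) :=
      hrx.zero_mul_isBoundedUnder_le
        (isBoundedUnder_of_eventually_le (a := C) (hvK.mono fun y hy => hC _ hy))
    have h3 := h2.sub (hsmall i (fun w => (M *ᵥ w) i) (hmulVec i))
    rw [sub_zero] at h3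
    refine h3.congr' (hev.mono fun y hy => ?_)
    have h4 := congrFun (hv y hy).2 i
    rw [← mulVec_mulVec, mulVec_diagonal, Pi.smul_apply, smul_eq_mul] at h4
    linear_combination -h4
  have hvlim : Tendsto v (𝓝 x) (𝓝 ((η ⬝ᵥ ξ)⁻¹ • ξ)) := by
    -- The vanishing residual makes every cluster point an eigenvector at `x`; simplicity and
    -- normalization then determine it.
    refine hKc.tendsto_nhds_of_unique_mapClusterPt hvK fun w hw hcl => ?_
    have hAw : (diagonal (fun i => x i) * M) *ᵥ w = r x • w := by
      ext i
      have hcont : Continuous fun w : Fin N → ℝ => x i * (M *ᵥ w) i - r x * w i :=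
        (continuous_const.mul (hmulVec i)).sub (continuous_const.mul (continuous_apply i))
      have hcl' := hcl.continuousAt_comp hcont.continuousAt
      have h0 : x i * (M *ᵥ w) i - r x * w i = 0 := by
        have : (𝓝 (x i * (M *ᵥ w) i - r x * w i) ⊓ 𝓝 (0 : ℝ)).NeBot :=
          hcl'.clusterPt.mono (hres i)
        exact eq_of_nhds_neBot this
      rw [← mulVec_mulVec, mulVec_diagonal, Pi.smul_apply, smul_eq_mul]
      linarith
    obtain ⟨t, rfl⟩ := exists_eq_smul_of_pos_eigenvector (diagonal_mul_pos hM hx) h.right_pos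
      h.right_eigen hAw
    have ht := hw.2
    rw [dotProduct_smul, smul_eq_mul] at ht
    rw [eq_inv_of_mul_eq_one_left ht]
  set g : EuclideanSpace ℝ (Fin N) → EuclideanSpace ℝ (Fin N) := fun y =>
    WithLp.toLp 2 (diagonal η *ᵥ (M *ᵥ v y)) with hg
  have hglim : Tendsto g (𝓝 x) (𝓝 (WithLp.toLp 2 ((η ⬝ᵥ ξ)⁻¹ • diagonal η *ᵥ (M *ᵥ ξ)))) := by
    rw [← mulVec_smul, ← mulVec_smul]
    have hc : Continuous fun w : Fin N → ℝ => WithLp.toLp 2 (diagonal η *ᵥ (M *ᵥ w)) :=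
      (PiLp.continuous_toLp 2 _).comp
        (continuous_const.matrix_mulVec (continuous_const.matrix_mulVec continuous_id))
    exact (hc.tendsto _).comp hvlim
  rw [hasGradientAt_iff_isLittleO, Asymptotics.isLittleO_iff]
  intro c hc
  filter_upwards [hsub, hglim.eventually (Metric.ball_mem_nhds _ hc)] with y hy hgy
  have hinner : r y - r x = inner ℝ (g y) (y - x) := by
    rw [hy, PiLp.inner_apply]
    refine Finset.sum_congr rfl fun i _ => ?_
    have hgi : g y i = η i * (M *ᵥ v y) i := mulVec_diagonal η (M *ᵥ v y) i
    simp [hgi]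
  -- The remainder is the inner product of `y - x` with `g y` minus its limit; Cauchy–Schwarz makes
  -- it `o(‖y - x‖)`.
  rw [hinner, ← inner_sub_left]
  refine (norm_inner_le_norm _ _).trans (mul_le_mul_of_nonneg_right ?_ (norm_nonneg _))
  rw [← dist_eq_norm]
  exact (Metric.mem_ball.mp hgy).le

end SpectralRadiusFun

theorem fact9 {N : ℕ} (hN : 0 < N) (M : Matrix (Fin N) (Fin N) ℝ) (hM : ∀ i j, 0 < M i j)
    (x : EuclideanSpace ℝ (Fin N)) (hx : ∀ i, 0 < x i) :
    -- `ρ(diag(x) M)` is positive and is the usual spectral radius of the matrix `diag(x) M`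
    0 < matrixSpectralRadiusFun M x ∧
    spectralRadius ℂ (((Matrix.diagonal fun i => x i) * M).map Complex.ofReal) =
      ENNReal.ofReal (matrixSpectralRadiusFun M x) ∧
    -- positive right and left Perron eigenvectors exist
    (∃ ξ η : Fin N → ℝ, IsPositiveEigenpair ((Matrix.diagonal fun i => x i) * M)
      (matrixSpectralRadiusFun M x) ξ η) ∧
    -- Fréchet differentiability, with the gradient given by any such eigenvectors
    DifferentiableAt ℝ (matrixSpectralRadiusFun M) x ∧
    ∀ ξ η : Fin N → ℝ,
      IsPositiveEigenpair ((Matrix.diagonal fun i => x i) * M)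
        (matrixSpectralRadiusFun M x) ξ η →
      HasGradientAt (matrixSpectralRadiusFun M)
        (WithLp.toLp 2 ((dotProduct η ξ)⁻¹ •
          Matrix.mulVec (Matrix.diagonal η) (M.mulVec ξ))) x := by
  have : Nonempty (Fin N) := ⟨⟨0, hN⟩⟩
  have hA := diagonal_mul_pos hM hx
  obtain ⟨hpos, ξ, η, h⟩ := exists_isPositiveEigenpair hA
  rw [← matrixSpectralRadiusFun_eq] at hpos h
  exact ⟨hpos,
    spectralRadius_map_ofReal_eq (fun i j => (hA i j).le) h.right_pos h.left_pos h.right_eigen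
      h.left_eigen,
    ⟨ξ, η, h⟩, (hasGradientAt_matrixSpectralRadiusFun hM hx h).differentiableAt,
    fun _ _ h' => hasGradientAt_matrixSpectralRadiusFun hM hx h'⟩
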